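/- Let $\delta(0),\delta(1),\dots$ be i.i.d. real random variables with finite mean and finite, nonzero variance. For $0<\gamma<1$ put $\bar\gamma=1-\gamma$ and $$B^r=\sum_{m=0}^{\infty}\delta(m)\,\bar\gamma^{\,m}.$$ This series converges absolutely almost surely, and $B^r$ has finite mean and finite, nonzero variance. As $\gamma\to 0$ (with $0<\gamma<1$), the normalized random variable $$Z=\frac{B^r-\mathbb{E}[B^r]}{\sqrt{\operatorname{Var}[B^r]}}$$ converges in distribution to a standard normal random variable. -/

import Mathlib

open MeasureTheory ProbabilityTheory Filter Topology

/-- The steady state `B^r = ∑_{m ≥ 0} δ(m) (1 - γ)^m` of the reference system with net charge `δ`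
and leakage ratio `γ`, as a function on the sample space. -/
noncomputable def referenceSteadyState {Ω : Type*} (δ : ℕ → Ω → ℝ) (γ : ℝ) (ω : Ω) : ℝ :=
  ∑' m : ℕ, δ m ω * (1 - γ) ^ m

/-- The normalization `(X - E[X]) / √Var[X]` of a random variable `X`. -/
noncomputable def standardize {Ω : Type*} [MeasurableSpace Ω] (μ : Measure Ω) (X : Ω → ℝ)
    (ω : Ω) : ℝ :=
  (X ω - ∫ ω', X ω' ∂μ) / √(variance X μ)

/-! Put `a = 1 - γ` and let `X m` be the standardized `δ m`. The standardized discounted sum is `∑ w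
m * X m` with `w m = √(1 - a ^ 2) * a ^ m`. The squared weights sum to one, while the largest
weight, `w 0 = √(1 - a ^ 2)`, tends to 0 as `a → 1`: no summand dominates. The standard Gaussian
characteristic function at `t` is the infinite product of its values at `w m * t`. Exchanging
factors one by one costs at most `∑ o((w m * t) ^ 2)`, which is at most `ε * t ^ 2` once `w 0 * t`
is small (`norm_charFun_map_sub_charFun_gaussianReal_le`). Lévy's continuity theorem concludes. -/

/-- A series of nonnegative integrable functions with summable integrals is almost everywhere
summable, with integrable sum. -/
lemma ae_summable_and_integrable_tsum_of_nonneg {Ω : Type*} [MeasurableSpace Ω] {μ : Measure Ω}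
    {F : ℕ → Ω → ℝ} (hF : ∀ m, Integrable (F m) μ) (hF0 : ∀ m ω, 0 ≤ F m ω)
    (hsum : Summable fun m => ∫ ω, F m ω ∂μ) :
    (∀ᵐ ω ∂μ, Summable fun m => F m ω) ∧ Integrable (fun ω => ∑' m, F m ω) μ := by
  have hlin : ∫⁻ ω, ∑' m, ENNReal.ofReal (F m ω) ∂μ < ⊤ := by
    rw [lintegral_tsum fun m => (hF m).aemeasurable.ennreal_ofReal]
    simp_rw [← fun m => ofReal_integral_eq_lintegral_ofReal (hF m) (ae_of_all _ (hF0 m))]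
    exact hsum.tsum_ofReal_lt_top
  have hmeas : AEMeasurable (fun ω => ∑' m, ENNReal.ofReal (F m ω)) μ :=
    AEMeasurable.tsum fun m => (hF m).aemeasurable.ennreal_ofReal
  have hae : ∀ᵐ ω ∂μ, Summable fun m => F m ω := by
    filter_upwards [ae_lt_top' hmeas hlin.ne] with ω hω
    simpa [ENNReal.toReal_ofReal (hF0 _ ω)] using ENNReal.summable_toReal hω.ne
  refine ⟨hae, ?_, ?_⟩
  · refine aestronglyMeasurable_of_tendsto_ae atTop
      (f := fun n ω => ∑ m ∈ Finset.range n, F m ω)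
      (fun n => Finset.aestronglyMeasurable_fun_sum _ fun m _ => (hF m).1) ?_
    filter_upwards [hae] with ω hω using hω.hasSum.tendsto_sum_nat
  · refine lt_of_le_of_lt (lintegral_mono_ae ?_) hlin
    filter_upwards [hae] with ω hω
    rw [Real.enorm_of_nonneg (tsum_nonneg fun m => hF0 m ω),
      ENNReal.ofReal_tsum_of_nonneg (fun m => hF0 m ω) hω]

/-- Cauchy–Schwarz for the geometric weights `a ^ m`. -/
lemma sq_sum_mul_geometric_le {a : ℝ} (ha0 : 0 ≤ a) (ha1 : a < 1) (x : ℕ → ℝ) (n : ℕ) :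
    (∑ m ∈ Finset.range n, x m * a ^ m) ^ 2 ≤
      (1 - a)⁻¹ * ∑ m ∈ Finset.range n, x m ^ 2 * a ^ m := by
  refine (Finset.sum_sq_le_sum_mul_sum_of_sq_le_mul (Finset.range n) (f := fun m => a ^ m)
    (g := fun m => x m ^ 2 * a ^ m) (fun m _ => by positivity) (fun m _ => by positivity)
    (fun m _ => le_of_eq (by ring))).trans ?_
  refine mul_le_mul_of_nonneg_right ?_ (Finset.sum_nonneg fun m _ => by positivity)
  rw [← tsum_geometric_of_lt_one ha0 ha1]
  exact (summable_geometric_of_lt_one ha0 ha1).sum_le_tsum _ fun m _ => by positivity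

/-- Products of complex numbers in the unit disc differ by at most the sum of the differences. -/
lemma norm_prod_sub_prod_le_sum {ι : Type*} (s : Finset ι) (f g : ι → ℂ)
    (hf : ∀ i, ‖f i‖ ≤ 1) (hg : ∀ i, ‖g i‖ ≤ 1) :
    ‖∏ i ∈ s, f i - ∏ i ∈ s, g i‖ ≤ ∑ i ∈ s, ‖f i - g i‖ := by
  classical
  induction s using Finset.induction with
  | empty => simp
  | insert i s hi ih =>
    rw [Finset.prod_insert hi, Finset.prod_insert hi, Finset.sum_insert hi]
    have hfs : ‖∏ j ∈ s, f j‖ ≤ 1 := by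
      rw [norm_prod]
      exact Finset.prod_le_one (fun _ _ => norm_nonneg _) fun j _ => hf j
    calc ‖f i * ∏ j ∈ s, f j - g i * ∏ j ∈ s, g j‖
        = ‖(f i - g i) * ∏ j ∈ s, f j + g i * (∏ j ∈ s, f j - ∏ j ∈ s, g j)‖ := by
          congr 1; ring
      _ ≤ ‖f i - g i‖ * ‖∏ j ∈ s, f j‖ + ‖g i‖ * ‖∏ j ∈ s, f j - ∏ j ∈ s, g j‖ := by
          refine (norm_add_le _ _).trans ?_
          rw [norm_mul, norm_mul]
      _ ≤ ‖f i - g i‖ * 1 + 1 * ∑ j ∈ s, ‖f j - g j‖ := by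
          gcongr
          exact hg i
      _ = _ := by ring

/-- The characteristic function of a standardized random variable agrees with that of the standard
Gaussian up to `o(s ^ 2)` at the origin. -/
lemma charFun_sub_charFun_gaussianReal_isLittleO {Ω : Type*} [MeasurableSpace Ω] {μ : Measure Ω}
    [IsProbabilityMeasure μ] {X : Ω → ℝ} (hX : AEMeasurable X μ) (h0 : ∫ ω, X ω ∂μ = 0)
    (h1 : ∫ ω, X ω ^ 2 ∂μ = 1) :
    (fun s => charFun (μ.map X) s - charFun (gaussianReal 0 1) s) =o[𝓝 0] fun s : ℝ => s ^ 2 := by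
  have hG := taylor_charFun_two (P := gaussianReal 0 1) (X := id) aemeasurable_id (by simp) (by
    have := variance_eq_sub (memLp_id_gaussianReal (μ := 0) (v := 1) 2)
    simpa using this.symm)
  rw [Measure.map_id] at hG
  -- Both expansions have the same second-order polynomial `1 - s ^ 2 / 2`, which cancels.
  refine ((taylor_charFun_two hX h0 (by simpa using h1)).sub hG).congr_left fun s => ?_
  ring

/-- Characteristic functions converge along almost surely converging sequences. -/
lemma tendsto_charFun_map_of_ae_tendsto {Ω : Type*} [MeasurableSpace Ω] {μ : Measure Ω}
    [IsProbabilityMeasure μ] {X : ℕ → Ω → ℝ} {Y : Ω → ℝ} (hX : ∀ n, AEMeasurable (X n) μ)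
    (hY : AEMeasurable Y μ) (h : ∀ᵐ ω ∂μ, Tendsto (fun n => X n ω) atTop (𝓝 (Y ω))) (t : ℝ) :
    Tendsto (fun n => charFun (μ.map (X n)) t) atTop (𝓝 (charFun (μ.map Y) t)) :=
  ProbabilityMeasure.tendsto_iff_tendsto_charFun.1
    (tendstoInDistribution_of_ae_tendsto hX hY h).tendsto t

/-! ### Convergence and moments of the discounted sum -/

section DiscountedSum

variable {Ω : Type*} [MeasurableSpace Ω] {μ : Measure Ω} {δ : ℕ → Ω → ℝ} {a : ℝ}

lemma aemeasurable_standardize {X : Ω → ℝ} (hX : AEMeasurable X μ) :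
    AEMeasurable (standardize μ X) μ :=
  (hX.sub_const _).div_const _

/-- Used with `g = |·|` for absolute convergence and with `g = (·) ^ 2` for a dominating function.
-/
lemma ae_summable_and_integrable_comp_mul_geometric (hident : ∀ n, IdentDistrib (δ n) (δ 0) μ μ)
    (ha0 : 0 ≤ a) (ha1 : a < 1) {g : ℝ → ℝ} (hg : Measurable g) (hg0 : ∀ x, 0 ≤ g x)
    (hint : Integrable (fun ω => g (δ 0 ω)) μ) :
    (∀ᵐ ω ∂μ, Summable fun m => g (δ m ω) * a ^ m) ∧
      Integrable (fun ω => ∑' m, g (δ m ω) * a ^ m) μ := by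
  have hid := fun m => (hident m).comp hg
  refine ae_summable_and_integrable_tsum_of_nonneg
    (fun m => ((hid m).integrable_iff.2 hint).mul_const _)
    (fun m ω => mul_nonneg (hg0 _) (by positivity)) ?_
  have : ∀ m, ∫ ω, g (δ m ω) * a ^ m ∂μ = (∫ ω, g (δ 0 ω) ∂μ) * a ^ m := fun m => by
    rw [integral_mul_const]
    congr 1
    exact (hid m).integral_eq
  simp_rw [this]
  exact (summable_geometric_of_lt_one ha0 ha1).mul_left _

lemma memLp_sum_mul_geometric (hident : ∀ n, IdentDistrib (δ n) (δ 0) μ μ)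
    (hL2 : MemLp (δ 0) 2 μ) (n : ℕ) :
    MemLp (fun ω => ∑ m ∈ Finset.range n, δ m ω * a ^ m) 2 μ :=
  memLp_finsetSum _ fun m _ => ((hident m).memLp_iff.2 hL2).mul_const _

/-- The characteristic function of a weighted sum of independent copies of `δ 0`. -/
lemma charFun_map_sum_mul_eq_prod (hindep : iIndepFun δ μ)
    (hident : ∀ n, IdentDistrib (δ n) (δ 0) μ μ) (w : ℕ → ℝ) (n : ℕ) (t : ℝ) :
    charFun (μ.map fun ω => ∑ m ∈ Finset.range n, w m * δ m ω) t =
      ∏ m ∈ Finset.range n, charFun (μ.map (δ 0)) (w m * t) := by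
  have hind : iIndepFun (fun m ω => w m * δ m ω) μ :=
    hindep.comp (fun m x => w m * x) fun m => by fun_prop
  rw [(hind.restrict _).charFun_map_fun_finsetSum_eq_prod
    fun m _ => (hident m).aemeasurable_fst.const_mul _, Finset.prod_apply]
  refine Finset.prod_congr rfl fun m _ => ?_
  rw [charFun_map_mul_comp (hident m).aemeasurable_fst, (hident m).map_eq]

variable [IsProbabilityMeasure μ]

lemma ae_summable_abs_mul_geometric (hident : ∀ n, IdentDistrib (δ n) (δ 0) μ μ)
    (hL2 : MemLp (δ 0) 2 μ) (ha0 : 0 ≤ a) (ha1 : a < 1) :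
    ∀ᵐ ω ∂μ, Summable fun m => |δ m ω * a ^ m| := by
  have h := (ae_summable_and_integrable_comp_mul_geometric hident ha0 ha1 (g := fun x => |x|)
    (by fun_prop) abs_nonneg (hL2.integrable one_le_two).abs).1
  filter_upwards [h] with ω hω
  simpa [abs_mul, abs_of_nonneg (pow_nonneg ha0 _)] using hω

lemma ae_tendsto_sum_mul_geometric (hident : ∀ n, IdentDistrib (δ n) (δ 0) μ μ)
    (hL2 : MemLp (δ 0) 2 μ) (ha0 : 0 ≤ a) (ha1 : a < 1) :
    ∀ᵐ ω ∂μ, Tendsto (fun n => ∑ m ∈ Finset.range n, δ m ω * a ^ m) atTop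
      (𝓝 (∑' m, δ m ω * a ^ m)) := by
  filter_upwards [ae_summable_abs_mul_geometric hident hL2 ha0 ha1] with ω hω
  exact hω.of_abs.hasSum.tendsto_sum_nat

/-- The discounted sum is square integrable, and its mean and second moment are the limits of
those of the partial sums. -/
lemma memLp_and_tendsto_moments_tsum_mul_geometric (hident : ∀ n, IdentDistrib (δ n) (δ 0) μ μ)
    (hL2 : MemLp (δ 0) 2 μ) (ha0 : 0 ≤ a) (ha1 : a < 1) :
    MemLp (fun ω => ∑' m, δ m ω * a ^ m) 2 μ ∧
    Tendsto (fun n => ∫ ω, ∑ m ∈ Finset.range n, δ m ω * a ^ m ∂μ) atTop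
      (𝓝 (∫ ω, ∑' m, δ m ω * a ^ m ∂μ)) ∧
    Tendsto (fun n => ∫ ω, (∑ m ∈ Finset.range n, δ m ω * a ^ m) ^ 2 ∂μ) atTop
      (𝓝 (∫ ω, (∑' m, δ m ω * a ^ m) ^ 2 ∂μ)) := by
  obtain ⟨hs, hi⟩ := ae_summable_and_integrable_comp_mul_geometric hident ha0 ha1
    (g := fun x => x ^ 2) (by fun_prop) sq_nonneg hL2.integrable_sq
  have hlim := ae_tendsto_sum_mul_geometric hident hL2 ha0 ha1
  have hmeas := fun n => (memLp_sum_mul_geometric (a := a) hident hL2 n).1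
  have hG := hi.const_mul (1 - a)⁻¹
  -- Cauchy–Schwarz puts all squared partial sums below one integrable function, independent of `n`.
  have hbound : ∀ n, ∀ᵐ ω ∂μ, (∑ m ∈ Finset.range n, δ m ω * a ^ m) ^ 2 ≤
      (1 - a)⁻¹ * ∑' m, δ m ω ^ 2 * a ^ m := fun n => by
    filter_upwards [hs] with ω hω
    refine (sq_sum_mul_geometric_le ha0 ha1 _ n).trans ?_
    refine mul_le_mul_of_nonneg_left ?_ (inv_nonneg.2 (sub_nonneg.2 ha1.le))
    exact hω.sum_le_tsum _ fun m _ => by positivity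
  refine ⟨?_, ?_, ?_⟩
  · have hB : AEStronglyMeasurable (fun ω => ∑' m, δ m ω * a ^ m) μ :=
      aestronglyMeasurable_of_tendsto_ae atTop hmeas hlim
    refine (memLp_two_iff_integrable_sq hB).2 (hG.mono' (hB.pow 2) ?_)
    filter_upwards [hlim, ae_all_iff.2 hbound] with ω hω hb
    rw [Real.norm_of_nonneg (sq_nonneg _)]
    exact le_of_tendsto (hω.pow 2) (Eventually.of_forall hb)
  -- First powers are dominated through `|x| ≤ 1 + x ^ 2`.
  · refine tendsto_integral_of_dominated_convergence _ hmeas ((integrable_const 1).add hG) ?_ hlim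
    intro n
    filter_upwards [hbound n] with ω hω
    rw [Real.norm_eq_abs]
    set x := ∑ m ∈ Finset.range n, δ m ω * a ^ m
    refine le_trans ?_ (add_le_add_right hω 1)
    rw [← sq_abs]
    nlinarith [sq_nonneg (|x| - 1), sq_nonneg |x|]
  · refine tendsto_integral_of_dominated_convergence _ (fun n => (hmeas n).pow 2) hG ?_
      (hlim.mono fun ω hω => hω.pow 2)
    intro n
    filter_upwards [hbound n] with ω hω
    rwa [Real.norm_of_nonneg (sq_nonneg _)]

lemma integral_tsum_mul_geometric (hident : ∀ n, IdentDistrib (δ n) (δ 0) μ μ)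
    (hL2 : MemLp (δ 0) 2 μ) (ha0 : 0 ≤ a) (ha1 : a < 1) :
    ∫ ω, ∑' m, δ m ω * a ^ m ∂μ = (∫ ω, δ 0 ω ∂μ) * (1 - a)⁻¹ := by
  refine tendsto_nhds_unique
    (memLp_and_tendsto_moments_tsum_mul_geometric hident hL2 ha0 ha1).2.1 ?_
  have : ∀ n, ∫ ω, ∑ m ∈ Finset.range n, δ m ω * a ^ m ∂μ =
      (∫ ω, δ 0 ω ∂μ) * ∑ m ∈ Finset.range n, a ^ m := fun n => by
    rw [integral_finsetSum _ fun m _ =>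
      (((hident m).memLp_iff.2 hL2).integrable one_le_two).mul_const _, Finset.mul_sum]
    simp_rw [integral_mul_const, fun m => (hident m).integral_eq]
  simp_rw [this]
  exact (hasSum_geometric_of_lt_one ha0 ha1).tendsto_sum_nat.const_mul _

lemma variance_tsum_mul_geometric (hindep : iIndepFun δ μ)
    (hident : ∀ n, IdentDistrib (δ n) (δ 0) μ μ)
    (hL2 : MemLp (δ 0) 2 μ) (ha0 : 0 ≤ a) (ha1 : a < 1) :
    variance (fun ω => ∑' m, δ m ω * a ^ m) μ = variance (δ 0) μ * (1 - a ^ 2)⁻¹ := by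
  obtain ⟨hB, h1, h2⟩ := memLp_and_tendsto_moments_tsum_mul_geometric hident hL2 ha0 ha1
  have hL := fun m => ((hident m).memLp_iff.2 hL2).mul_const (a ^ m)
  have hfin : ∀ n, variance (fun ω => ∑ m ∈ Finset.range n, δ m ω * a ^ m) μ =
      variance (δ 0) μ * ∑ m ∈ Finset.range n, (a ^ 2) ^ m := fun n => by
    have hind : iIndepFun (fun m ω => δ m ω * a ^ m) μ :=
      hindep.comp (fun m x => x * a ^ m) fun m => by fun_prop
    have := IndepFun.variance_sum (s := Finset.range n) (fun m _ => hL m)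
      fun i _ j _ hij => hind.indepFun hij
    have hsum : (∑ m ∈ Finset.range n, fun ω => δ m ω * a ^ m) =
        fun ω => ∑ m ∈ Finset.range n, δ m ω * a ^ m := by
      ext ω
      simp
    rw [hsum] at this
    rw [this, Finset.mul_sum]
    refine Finset.sum_congr rfl fun m _ => ?_
    rw [variance_mul_const, (hident m).variance_eq]
    ring
  have hv : Tendsto (fun n => variance (fun ω => ∑ m ∈ Finset.range n, δ m ω * a ^ m) μ) atTop
      (𝓝 (variance (fun ω => ∑' m, δ m ω * a ^ m) μ)) := by
    rw [variance_eq_sub hB]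
    simp_rw [fun n => variance_eq_sub (memLp_sum_mul_geometric (a := a) hident hL2 n)]
    exact h2.sub (h1.pow 2)
  refine tendsto_nhds_unique hv ?_
  simp_rw [hfin]
  exact (hasSum_geometric_of_lt_one (sq_nonneg a)
    (pow_lt_one₀ ha0 ha1 two_ne_zero)).tendsto_sum_nat.const_mul _

/-! ### Comparison with the Gaussian -/

/-- If the squared weights sum to one and the characteristic function of the summands is Gaussian up
to `ε s ^ 2` at the relevant arguments, then so is that of the limit of the weighted sums. -/
lemma norm_charFun_map_sub_charFun_gaussianReal_le (hindep : iIndepFun δ μ)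
    (hident : ∀ n, IdentDistrib (δ n) (δ 0) μ μ) {w : ℕ → ℝ} (hw : HasSum (fun m => w m ^ 2) 1)
    {Y : Ω → ℝ} (hY : AEMeasurable Y μ)
    (hlim : ∀ᵐ ω ∂μ, Tendsto (fun n => ∑ m ∈ Finset.range n, w m * δ m ω) atTop (𝓝 (Y ω)))
    {ε t : ℝ} (hε : 0 ≤ ε) (hbound : ∀ m, ‖charFun (μ.map (δ 0)) (w m * t) -
      charFun (gaussianReal 0 1) (w m * t)‖ ≤ ε * (w m * t) ^ 2) :
    ‖charFun (μ.map Y) t - charFun (gaussianReal 0 1) t‖ ≤ ε * t ^ 2 := by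
  have := Measure.isProbabilityMeasure_map (μ := μ) (hident 0).aemeasurable_snd
  have h1 := tendsto_charFun_map_of_ae_tendsto (fun n => Finset.aemeasurable_fun_sum
    (Finset.range n) fun m _ => (hident m).aemeasurable_fst.const_mul (w m)) hY hlim t
  have h2 : Tendsto (fun n => ∏ m ∈ Finset.range n, charFun (gaussianReal 0 1) (w m * t)) atTop
      (𝓝 (charFun (gaussianReal 0 1) t)) := by
    have hprod : ∀ n, ∏ m ∈ Finset.range n, charFun (gaussianReal 0 1) (w m * t) =
        Complex.exp (((-(t ^ 2 / 2) * ∑ m ∈ Finset.range n, w m ^ 2 : ℝ) : ℂ)) := fun n => by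
      simp_rw [charFun_gaussianReal]
      rw [← Complex.exp_sum]
      congr 1
      push_cast
      rw [Finset.mul_sum]
      refine Finset.sum_congr rfl fun m _ => ?_
      simp
      ring
    simp_rw [hprod]
    have hE : charFun (gaussianReal 0 1) t = Complex.exp (((-(t ^ 2 / 2) * 1 : ℝ) : ℂ)) := by
      rw [charFun_gaussianReal]
      congr 1
      simp
    rw [hE]
    exact (Complex.continuous_exp.comp Complex.continuous_ofReal).continuousAt.tendsto.comp
      (hw.tendsto_sum_nat.const_mul _)
  refine le_of_tendsto (h1.sub h2).norm (Eventually.of_forall fun n => ?_)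
  rw [charFun_map_sum_mul_eq_prod hindep hident]
  calc _ ≤ ∑ m ∈ Finset.range n, ‖charFun (μ.map (δ 0)) (w m * t) -
          charFun (gaussianReal 0 1) (w m * t)‖ :=
        norm_prod_sub_prod_le_sum _ _ _ (fun _ => norm_charFun_le_one _)
          fun _ => norm_charFun_le_one _
    _ ≤ ∑ m ∈ Finset.range n, ε * t ^ 2 * w m ^ 2 :=
        Finset.sum_le_sum fun m _ => (hbound m).trans_eq (by ring)
    _ = ε * t ^ 2 * ∑ m ∈ Finset.range n, w m ^ 2 := by rw [Finset.mul_sum]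
    _ ≤ ε * t ^ 2 * 1 := by
        gcongr
        exact sum_le_hasSum _ (fun m _ => sq_nonneg _) hw
    _ = ε * t ^ 2 := mul_one _

/-- The standardized discounted sum is the almost sure limit of weighted sums of the standardized
summands. -/
lemma ae_tendsto_standardize_tsum_mul_geometric (hindep : iIndepFun δ μ)
    (hident : ∀ n, IdentDistrib (δ n) (δ 0) μ μ)
    (hL2 : MemLp (δ 0) 2 μ) (ha0 : 0 ≤ a) (ha1 : a < 1) :
    ∀ᵐ ω ∂μ, Tendsto (fun n => ∑ m ∈ Finset.range n, √(1 - a ^ 2) * a ^ m *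
        ((δ m ω - ∫ ω', δ 0 ω' ∂μ) / √(variance (δ 0) μ))) atTop
      (𝓝 (standardize μ (fun ω => ∑' m, δ m ω * a ^ m) ω)) := by
  filter_upwards [ae_tendsto_sum_mul_geometric hident hL2 ha0 ha1] with ω hω
  have hg := (hasSum_geometric_of_lt_one ha0 ha1).tendsto_sum_nat.const_mul (∫ ω', δ 0 ω' ∂μ)
  -- The factor is the inverse standard deviation of the discounted sum.
  have h := (hω.sub hg).const_mul (√(1 - a ^ 2) / √(variance (δ 0) μ))
  rw [standardize, integral_tsum_mul_geometric hident hL2 ha0 ha1,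
    variance_tsum_mul_geometric hindep hident hL2 ha0 ha1, Real.sqrt_mul (variance_nonneg _ _),
    Real.sqrt_inv]
  convert h using 2
  · rw [Finset.mul_sum, ← Finset.sum_sub_distrib, Finset.mul_sum]
    refine Finset.sum_congr rfl fun m _ => ?_
    ring
  · rw [div_mul_eq_div_div, div_inv_eq_mul]
    ring

/-- Pointwise convergence of the characteristic functions of the standardized discounted sums. -/
lemma tendsto_charFun_standardize_tsum_mul_geometric (hindep : iIndepFun δ μ)
    (hident : ∀ n, IdentDistrib (δ n) (δ 0) μ μ) (hL2 : MemLp (δ 0) 2 μ)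
    (hvar : 0 < variance (δ 0) μ) (t : ℝ) :
    Tendsto (fun a : ℝ => charFun (μ.map (standardize μ fun ω => ∑' m, δ m ω * a ^ m)) t)
      (𝓝[Set.Ico 0 1] 1) (𝓝 (charFun (gaussianReal 0 1) t)) := by
  set X : ℕ → Ω → ℝ := fun m ω => (δ m ω - ∫ ω', δ 0 ω' ∂μ) / √(variance (δ 0) μ) with hXdef
  have hu : Measurable fun x : ℝ => (x - ∫ ω', δ 0 ω' ∂μ) / √(variance (δ 0) μ) := by fun_prop
  have hXind : iIndepFun X μ := hindep.comp (fun _ => _) fun _ => hu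
  have hXid : ∀ n, IdentDistrib (X n) (X 0) μ μ := fun n => (hident n).comp hu
  have hX0 : ∫ ω, X 0 ω ∂μ = 0 := by
    simp only [hXdef]
    rw [integral_div, integral_sub (hL2.integrable one_le_two) (integrable_const _)]
    simp
  have hX1 : ∫ ω, X 0 ω ^ 2 ∂μ = 1 := by
    simp only [hXdef, div_pow]
    rw [integral_div, ← variance_eq_integral hL2.aemeasurable, Real.sq_sqrt hvar.le,
      div_self hvar.ne']
  have hlittle := charFun_sub_charFun_gaussianReal_isLittleO (hXid 0).aemeasurable_fst hX0 hX1
  rw [Metric.tendsto_nhds]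
  intro ε hε
  -- The `+ 1` makes `η * t ^ 2 < ε` hold also at `t = 0`.
  set η : ℝ := ε / (t ^ 2 + 1) with hη
  have hη0 : 0 < η := by positivity
  obtain ⟨ρ, hρ0, hρ⟩ := Metric.eventually_nhds_iff.1 (hlittle.bound hη0)
  -- Controlling the largest weight, at `m = 0`, brings every `w m * t` within `ρ` at once.
  have hsmall : ∀ᶠ a : ℝ in 𝓝[Set.Ico 0 1] 1, |√(1 - a ^ 2) * t| < ρ := by
    have hc : Tendsto (fun a : ℝ => |√(1 - a ^ 2) * t|) (𝓝 1) (𝓝 |√(1 - 1 ^ 2) * t|) :=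
      Continuous.tendsto (by fun_prop) 1
    refine (hc.mono_left nhdsWithin_le_nhds).eventually_lt_const ?_
    simpa using hρ0
  filter_upwards [hsmall, self_mem_nhdsWithin] with a hat ⟨ha0, ha1⟩
  have hq1 : a ^ 2 < 1 := pow_lt_one₀ ha0 ha1 two_ne_zero
  have hw : HasSum (fun m => (√(1 - a ^ 2) * a ^ m) ^ 2) 1 := by
    have := (hasSum_geometric_of_lt_one (sq_nonneg a) hq1).mul_left (1 - a ^ 2)
    rw [mul_inv_cancel₀ (by linarith)] at this
    have heq : ∀ m, (√(1 - a ^ 2) * a ^ m) ^ 2 = (1 - a ^ 2) * (a ^ 2) ^ m := fun m => by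
      rw [mul_pow, Real.sq_sqrt (by linarith)]
      ring
    simpa only [heq] using this
  have hB := (memLp_and_tendsto_moments_tsum_mul_geometric hident hL2 ha0 ha1).1
  rw [dist_eq_norm]
  refine (norm_charFun_map_sub_charFun_gaussianReal_le hXind hXid hw
    (aemeasurable_standardize hB.aemeasurable)
    (ae_tendsto_standardize_tsum_mul_geometric hindep hident hL2 ha0 ha1) hη0.le
    fun m => ?_).trans_lt ?_
  · have := @hρ (√(1 - a ^ 2) * a ^ m * t) (by
      rw [Real.dist_eq, sub_zero, mul_right_comm, abs_mul, abs_of_nonneg (pow_nonneg ha0 m)]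
      exact (mul_le_of_le_one_right (abs_nonneg _) (pow_le_one₀ ha0 ha1.le)).trans_lt hat)
    rwa [Real.norm_of_nonneg (sq_nonneg _)] at this
  · rw [hη, div_mul_eq_mul_div, div_lt_iff₀ (by positivity)]
    nlinarith

end DiscountedSum

theorem theorem6 {Ω : Type*} [MeasurableSpace Ω] (μ : Measure Ω) [IsProbabilityMeasure μ]
    (δ : ℕ → Ω → ℝ)
    (hindep : iIndepFun δ μ)
    (hident : ∀ n, IdentDistrib (δ n) (δ 0) μ μ)
    (hL2 : MemLp (δ 0) 2 μ)
    (hvar : 0 < variance (δ 0) μ) :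
    (∀ γ : ℝ, 0 < γ → γ < 1 →
      (∀ᵐ ω ∂μ, Summable fun m : ℕ => |δ m ω * (1 - γ) ^ m|) ∧
      MemLp (referenceSteadyState δ γ) 2 μ ∧
      0 < variance (referenceSteadyState δ γ) μ) ∧
    TendstoInDistribution
      (fun (γ : Set.Ioo (0 : ℝ) 1) (ω : Ω) => standardize μ (referenceSteadyState δ γ) ω)
      (comap (fun γ : Set.Ioo (0 : ℝ) 1 => (γ : ℝ)) (𝓝 0))
      (fun x : ℝ => x) (fun _ => μ) (gaussianReal 0 1) := by
  have hmem : ∀ γ : ℝ, 0 < γ → γ < 1 → MemLp (referenceSteadyState δ γ) 2 μ := fun γ h0 h1 =>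
    (memLp_and_tendsto_moments_tsum_mul_geometric hident hL2 (by linarith) (by linarith)).1
  refine ⟨fun γ h0 h1 => ⟨ae_summable_abs_mul_geometric hident hL2 (by linarith) (by linarith),
    hmem γ h0 h1, ?_⟩, ?_⟩
  · have := variance_tsum_mul_geometric (a := 1 - γ) hindep hident hL2 (by linarith) (by linarith)
    unfold referenceSteadyState
    rw [this]
    have : (1 - γ) ^ 2 < 1 := pow_lt_one₀ (by linarith) (by linarith) two_ne_zero
    exact mul_pos hvar (inv_pos.2 (by linarith))
  · refine ⟨fun γ => aemeasurable_standardize (hmem γ γ.2.1 γ.2.2).aemeasurable, by fun_prop, ?_⟩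
    -- The filter is countably generated, so Lévy's theorem need only be applied along sequences.
    refine tendsto_of_seq_tendsto fun u hu => ?_
    refine ProbabilityMeasure.tendsto_iff_tendsto_charFun.2 fun t => ?_
    have hu' : Tendsto (fun n => 1 - (u n : ℝ)) atTop (𝓝[Set.Ico 0 1] 1) := by
      refine tendsto_nhdsWithin_iff.2 ⟨?_, Eventually.of_forall fun n =>
        ⟨by linarith [(u n).2.2], by linarith [(u n).2.1]⟩⟩
      simpa using (tendsto_comap_iff.1 hu).const_sub 1
    have h := (tendsto_charFun_standardize_tsum_mul_geometric hindep hident hL2 hvar t).comp hu'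
    change Tendsto _ _ (𝓝 (charFun ((gaussianReal 0 1).map fun x => x) t))
    rw [Measure.map_id']
    exact h
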